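/- Let $\mathbb{R}_+=(0,\infty)$. For $x\in\mathbb{R}$ and $\beta,\lambda\in\mathbb{R}_+$ let \begin{align*} \mathrm{LeakyReLU}_\beta(x)&=\begin{cases}x,&x\ge 0,\\ \beta x,&x<0,\end{cases}& \mathrm{ELU}_\beta(x)&=\begin{cases}x,&x\ge 0,\\ \beta(e^x-1),&x<0,\end{cases}\\ \mathrm{CELU}_\beta(x)&=\begin{cases}x,&x\ge 0,\\ \beta(e^{x/\beta}-1),&x<0,\end{cases}& \mathrm{SELU}_{(\lambda,\beta)}(x)&=\lambda\,\mathrm{ELU}_\beta(x),\\ \mathrm{Softplus}_\beta(x)&=\tfrac1\beta\ln(1+e^{\beta x}), \end{align*} and let $\mathrm{LeakyReLU}$, $\mathrm{ELU}$, $\mathrm{CELU}$, $\mathrm{SELU}$, $\mathrm{Softplus}$ denote the corresponding classes of functions, each with its parameters ranging over $\mathbb{R}_+$. For a class $\sigma$ of functions $\mathbb{R}\to\mathbb{R}$ and integers $m,n\ge 1$, $k\ge 0$, let $N^{\sigma}_{m,n,k}$ be the set of all functions $\mathbb{R}^m\to\mathbb{R}^n$ of the form $$T_L\circ\sigma_L\circ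 T_{L-1}\circ\cdots\circ\sigma_1\circ T_0,$$ where $L\ge 1$, $d_0=m$, $d_{L+1}=n$, $1\le d_1,\dots,d_L\le k$, each $T_i:\mathbb{R}^{d_i}\to\mathbb{R}^{d_{i+1}}$ is an affine map, and each $\sigma_i\in\sigma$ is applied componentwise (different layers may use different members of $\sigma$). Let $$w_{\min}(m,n,\sigma)=\min\bigl\{l\in\mathbb{N} : \forall f\in C(\mathbb{R}^m,\mathbb{R}^n)\ \forall K\subset\mathbb{R}^m\text{ compact}\ \forall\varepsilon>0\ \exists g\in N^{\sigma}_{m,n,l}:\ \sup_{x\in K}\|f(x)-g(x)\|_\infty<\varepsilon\bigr\}.$$ **Theorem (Minimum width for variants of ReLU).** Let $m,n\ge 1$ be integers and let $\sigma$ be one of the classes $\mathrm{LeakyReLU}$, $\mathrm{ELU}$, $\mathrm{SELU}$, $\mathrm{Softplus}$, $\mathrm{CELU}$. Then the set of $l$ in the definition of $w_{\min}(m,n,\sigma)$ is nonempty, and $$m+1\le w_{\min}(m,n,\sigma)\le m+n.$$ -/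

import Mathlib

namespace MinWidth

/-- `LeakyReLU_β`. -/
noncomputable def leakyReLU (β x : ℝ) : ℝ := if 0 ≤ x then x else β * x

/-- `ELU_β`. -/
noncomputable def elu (β x : ℝ) : ℝ := if 0 ≤ x then x else β * (Real.exp x - 1)

/-- `CELU_β`. -/
noncomputable def celu (β x : ℝ) : ℝ := if 0 ≤ x then x else β * (Real.exp (x / β) - 1)

/-- `SELU_(lam, β)`. -/
noncomputable def selu (lam β x : ℝ) : ℝ :=
  lam * (if 0 ≤ x then x else β * (Real.exp x - 1))

/-- `Softplus_β`. -/
noncomputable def softplus (β x : ℝ) : ℝ := 1 / β * Real.log (1 + Real.exp (β * x))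

/-- The class of all leaky rectified linear units with positive parameter. -/
def LeakyReLU : Set (ℝ → ℝ) := {s | ∃ β : ℝ, 0 < β ∧ s = leakyReLU β}

/-- The class of all exponential linear units with positive parameter. -/
def ELU : Set (ℝ → ℝ) := {s | ∃ β : ℝ, 0 < β ∧ s = elu β}

/-- The class of all continuously differentiable exponential linear units with positive
parameter. -/
def CELU : Set (ℝ → ℝ) := {s | ∃ β : ℝ, 0 < β ∧ s = celu β}

/-- The class of all scaled exponential linear units with positive parameters. -/
def SELU : Set (ℝ → ℝ) := {s | ∃ lam β : ℝ, 0 < lam ∧ 0 < β ∧ s = selu lam β}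

/-- The class of all softplus functions with positive parameter. -/
def Softplus : Set (ℝ → ℝ) := {s | ∃ β : ℝ, 0 < β ∧ s = softplus β}

/-- The affine transformation `T_{W,b} x = W x + b`. -/
def affineMap {d e : ℕ} (W : Matrix (Fin e) (Fin d) ℝ) (b : Fin e → ℝ) (x : Fin d → ℝ) :
    Fin e → ℝ :=
  W.mulVec x + b

/-- A scalar activation function applied componentwise. -/
def componentwise {d : ℕ} (s : ℝ → ℝ) (x : Fin d → ℝ) : Fin d → ℝ := fun i => s (x i)

/-- `Nets σ m [d₁, …, d_L] n` is the set `N(σ; m, d₁, …, d_L, n)` of all functions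
`T_L ∘ s_L ∘ T_{L-1} ∘ ⋯ ∘ s₁ ∘ T₀`, where the `T_i` are affine transformations between spaces of
the prescribed dimensions and each `s_i ∈ σ` is applied componentwise. -/
def Nets (σ : Set (ℝ → ℝ)) : (m : ℕ) → List ℕ → (n : ℕ) → Set ((Fin m → ℝ) → (Fin n → ℝ))
  | m, [], n => {Φ | ∃ (W : Matrix (Fin n) (Fin m) ℝ) (b : Fin n → ℝ), Φ = affineMap W b}
  | m, d :: ds, n =>
      {Φ | ∃ (W : Matrix (Fin d) (Fin m) ℝ) (b : Fin d → ℝ), ∃ s ∈ σ, ∃ Ψ ∈ Nets σ d ds n,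
        Φ = Ψ ∘ componentwise s ∘ affineMap W b}

/-- `NetsOfWidth σ m n k`: the networks with input dimension `m`, output dimension `n`, at least
one hidden layer, and all hidden layers of dimension between `1` and `k`. -/
def NetsOfWidth (σ : Set (ℝ → ℝ)) (m n k : ℕ) : Set ((Fin m → ℝ) → (Fin n → ℝ)) :=
  {Φ | ∃ ds : List ℕ, ds ≠ [] ∧ (∀ d ∈ ds, 1 ≤ d ∧ d ≤ k) ∧ Φ ∈ Nets σ m ds n}

/-- `𝓐` compactly approximates `𝓑`: every member of `𝓑` is approximated by members of `𝓐`,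
uniformly on every compact set. The norm of `Fin n → ℝ` is the maximum norm. -/
def CompactlyApproximates {m n : ℕ} (𝓐 𝓑 : Set ((Fin m → ℝ) → (Fin n → ℝ))) : Prop :=
  ∀ f ∈ 𝓑, ∀ K : Set (Fin m → ℝ), IsCompact K → ∀ ε : ℝ, 0 < ε →
    ∃ g ∈ 𝓐, ∀ x ∈ K, ‖f x - g x‖ < ε

/-- The widths `l` for which the networks of width at most `l` compactly approximate all
continuous functions from `ℝᵐ` to `ℝⁿ`. -/
def sufficientWidths (m n : ℕ) (σ : Set (ℝ → ℝ)) : Set ℕ :=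
  {l | CompactlyApproximates (NetsOfWidth σ m n l) {f | Continuous f}}

/-- The minimum width `w_min(m, n, σ)`; it is the minimum of `sufficientWidths m n σ` when that set
is nonempty. -/
noncomputable def minWidth (m n : ℕ) (σ : Set (ℝ → ℝ)) : ℕ := sInf (sufficientWidths m n σ)

end MinWidth

namespace MinWidth

open Filter Topology

/-! ### Activation functions -/

/-! Lower bound. All five activations are continuous and strictly increasing, hence open maps. In a
net of width at most `m`, each layer with injective weights is an open self-map of `ℝᵐ`. At the
first non-injective layer the net is constant along a kernel direction; if there is none, the last
affine map is non-increasing along some direction. The image of the unit sphere under an open map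
meets every ray from the image of the centre, so each output coordinate at some unit vector is at
most its value at `0` (`exists_norm_eq_one_net_le`). Such a net cannot approximate `‖x‖`.

Upper bound. Each class approximates ReLU on bounded intervals. Width `m + n` carries the input `x`
in `m` neurons and a register `y` in the other `n`; one layer replaces `y` by its maximum or minimum
with an affine function of `x`. For points `a` in order of increasing Euclidean norm, `y` is clamped
between `f a - τ + 2M a⬝(x-a)` and `f a + τ - 2M a⬝(x-a)`. If `x` is close to a centre `p` of larger
norm, the clamp at `p` makes `y` accurate. Later centres `a` satisfy `|x| ≤ |a|`, so `2 a⬝(x-a) ≤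
-|x-a|²`, their clamps contain `f x` and do no harm (`exists_register_of_finset`). -/

theorem isOpenMap_of_strictMono_of_continuous {s : ℝ → ℝ} (hs : StrictMono s)
    (hc : Continuous s) : IsOpenMap s := by
  rw [isOpenMap_iff_nhds_le]
  intro x t ht
  rw [mem_map, Metric.mem_nhds_iff] at ht
  obtain ⟨r, hr, hrt⟩ := ht
  have h1 : s (x - r / 2) < s x := hs (by linarith)
  have h2 : s x < s (x + r / 2) := hs (by linarith)
  refine mem_of_superset (Icc_mem_nhds h1 h2) fun y hy => ?_
  obtain ⟨z, hz, rfl⟩ := intermediate_value_Icc (by linarith) hc.continuousOn hy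
  refine hrt ?_
  rw [Metric.mem_ball, Real.dist_eq, abs_lt]
  constructor <;> linarith [hz.1, hz.2]

theorem continuous_ite_nonneg {g : ℝ → ℝ} (hg : Continuous g) (h0 : g 0 = 0) :
    Continuous fun x : ℝ => if 0 ≤ x then x else g x :=
  Continuous.if_le continuous_id hg continuous_const continuous_id fun x hx => by
    subst hx; simp [h0]

theorem strictMono_ite_nonneg {g : ℝ → ℝ} (hg : StrictMono g) (h0 : g 0 = 0) :
    StrictMono fun x : ℝ => if 0 ≤ x then x else g x := by
  intro x y hxy
  dsimp only
  split_ifs with hx hy hy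
  · exact hxy
  · linarith
  · have := hg (not_le.1 hx); linarith
  · exact hg hxy

theorem strictMono_exp_div_sub_one {a b : ℝ} (ha : 0 < a) (hb : 0 < b) :
    StrictMono fun x : ℝ => a * (Real.exp (x / b) - 1) := by
  intro x y hxy
  have : Real.exp (x / b) < Real.exp (y / b) := Real.exp_lt_exp.2 (by gcongr)
  exact mul_lt_mul_of_pos_left (by linarith) ha

theorem elu_strictMono_continuous {β : ℝ} (hβ : 0 < β) :
    StrictMono (elu β) ∧ Continuous (elu β) :=
  ⟨strictMono_ite_nonneg (by simpa using strictMono_exp_div_sub_one hβ one_pos) (by simp),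
    continuous_ite_nonneg (by fun_prop) (by simp)⟩

theorem softplus_strictMono_continuous {β : ℝ} (hβ : 0 < β) :
    StrictMono (softplus β) ∧ Continuous (softplus β) := by
  constructor
  · intro x y hxy
    refine mul_lt_mul_of_pos_left (Real.log_lt_log (by positivity) ?_) (by positivity)
    have : Real.exp (β * x) < Real.exp (β * y) := Real.exp_lt_exp.2 (by gcongr)
    linarith
  · have : ∀ x : ℝ, 1 + Real.exp (β * x) ≠ 0 := fun x => by positivity
    unfold softplus
    fun_prop (disch := assumption)

/-- `σ` is one of the five classes of activation functions. -/
def IsReLUVariant (σ : Set (ℝ → ℝ)) : Prop :=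
  σ = LeakyReLU ∨ σ = ELU ∨ σ = SELU ∨ σ = Softplus ∨ σ = CELU

theorem IsReLUVariant.strictMono_continuous {σ : Set (ℝ → ℝ)} (hσ : IsReLUVariant σ)
    {s : ℝ → ℝ} (hs : s ∈ σ) : StrictMono s ∧ Continuous s := by
  obtain rfl | rfl | rfl | rfl | rfl := hσ
  · obtain ⟨β, hβ, rfl⟩ := hs
    exact ⟨strictMono_ite_nonneg (fun x y h => mul_lt_mul_of_pos_left h hβ) (by simp),
      continuous_ite_nonneg (by fun_prop) (by simp)⟩
  · obtain ⟨β, hβ, rfl⟩ := hs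
    exact elu_strictMono_continuous hβ
  · obtain ⟨lam, β, hl, hβ, rfl⟩ := hs
    obtain ⟨h1, h2⟩ := elu_strictMono_continuous hβ
    exact ⟨fun x y h => mul_lt_mul_of_pos_left (h1 h) hl, continuous_const.mul h2⟩
  · obtain ⟨β, hβ, rfl⟩ := hs
    exact softplus_strictMono_continuous hβ
  · obtain ⟨β, hβ, rfl⟩ := hs
    exact ⟨strictMono_ite_nonneg (strictMono_exp_div_sub_one hβ hβ) (by simp),
      continuous_ite_nonneg (by fun_prop) (by simp)⟩

/-- Members of `σ` are arbitrarily close to `ReLU` on bounded intervals. -/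
def ApproximatesReLU (σ : Set (ℝ → ℝ)) : Prop :=
  ∀ R ε : ℝ, 0 < ε → ∃ s ∈ σ, ∀ x : ℝ, |x| ≤ R → |s x - max x 0| < ε

theorem abs_ite_sub_max_lt {g : ℝ → ℝ} {x ε : ℝ} (hε : 0 < ε) (h : x < 0 → |g x| < ε) :
    |(if 0 ≤ x then x else g x) - max x 0| < ε := by
  split_ifs with hx
  · simpa [max_eq_left hx] using hε
  · simpa [max_eq_right (not_le.1 hx).le] using h (not_le.1 hx)

theorem abs_mul_exp_sub_one_lt {ε x : ℝ} (hε : 0 < ε) (hx : x < 0) :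
    |ε / 2 * (Real.exp x - 1)| < ε := by
  have h1 := Real.exp_pos x
  have h2 : Real.exp x < 1 := by simpa using hx
  rw [abs_lt]
  constructor <;> nlinarith

theorem abs_softplus_sub_max_le {β : ℝ} (hβ : 0 < β) (x : ℝ) :
    |softplus β x - max x 0| ≤ 1 / β * Real.log 2 := by
  have key : max x 0 = 1 / β * Real.log (Real.exp (β * max x 0)) := by
    rw [Real.log_exp]; field_simp
  have hle : Real.exp (β * max x 0) ≤ 1 + Real.exp (β * x) := by
    rcases le_total 0 x with h | h
    · rw [max_eq_left h]; linarith
    · rw [max_eq_right h, mul_zero, Real.exp_zero]; linarith [Real.exp_pos (β * x)]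
  have hge : 1 + Real.exp (β * x) ≤ 2 * Real.exp (β * max x 0) := by
    have h1 : Real.exp (β * x) ≤ Real.exp (β * max x 0) :=
      Real.exp_le_exp.2 (by gcongr; exact le_max_left _ _)
    have h2 : 1 ≤ Real.exp (β * max x 0) := Real.one_le_exp (by positivity)
    linarith
  have l1 := Real.log_le_log (Real.exp_pos _) hle
  have l2 := Real.log_le_log (by positivity) hge
  rw [Real.log_mul (by norm_num) (Real.exp_ne_zero _)] at l2
  have hb : 0 < 1 / β := by positivity
  unfold softplus
  nth_rewrite 1 [key]
  rw [← mul_sub, abs_of_nonneg (mul_nonneg hb.le (by linarith))]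
  exact mul_le_mul_of_nonneg_left (by linarith) hb.le

theorem IsReLUVariant.approximatesReLU {σ : Set (ℝ → ℝ)} (hσ : IsReLUVariant σ) :
    ApproximatesReLU σ := by
  intro R ε hε
  obtain rfl | rfl | rfl | rfl | rfl := hσ
  -- Only this class needs the bound `R`: the error is slope times `|x|`.
  · refine ⟨_, ⟨ε / (|R| + 1), by positivity, rfl⟩, fun x hx => abs_ite_sub_max_lt hε fun _ => ?_⟩
    rw [abs_mul, abs_of_pos (by positivity), div_mul_eq_mul_div, div_lt_iff₀ (by positivity)]
    have := le_abs_self R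
    gcongr
    linarith
  · exact ⟨_, ⟨ε / 2, by positivity, rfl⟩, fun x _ =>
      abs_ite_sub_max_lt (g := fun x => ε / 2 * (Real.exp x - 1)) hε (abs_mul_exp_sub_one_lt hε)⟩
  · refine ⟨_, ⟨1, ε / 2, one_pos, by positivity, rfl⟩, fun x _ => ?_⟩
    rw [selu, one_mul]
    exact abs_ite_sub_max_lt (g := fun x => ε / 2 * (Real.exp x - 1)) hε
      (abs_mul_exp_sub_one_lt hε)
  · refine ⟨_, ⟨1 / ε, by positivity, rfl⟩, fun x _ =>
      (abs_softplus_sub_max_le (by positivity) x).trans_lt ?_⟩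
    rw [one_div_one_div]
    exact mul_lt_of_lt_one_right hε (Real.log_two_lt_d9.trans (by norm_num))
  · refine ⟨_, ⟨ε / 2, by positivity, rfl⟩, fun x _ =>
      abs_ite_sub_max_lt (g := fun x => ε / 2 * (Real.exp (x / (ε / 2)) - 1)) hε fun hx => ?_⟩
    exact abs_mul_exp_sub_one_lt hε (div_neg_of_neg_of_pos hx (by positivity))

/-! ### The lower bound -/

/-- A ray issuing from an interior point of the image of the unit ball under a continuous open map
meets the image of the unit sphere. -/
theorem exists_mem_ray_of_isOpenMap {E F : Type*} [NormedAddCommGroup E] [ProperSpace E]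
    [NormedAddCommGroup F] [NormedSpace ℝ F] {h : E → F} (hc : Continuous h) (ho : IsOpenMap h)
    {v : F} (hv : v ≠ 0) : ∃ z : E, ‖z‖ = 1 ∧ ∃ t : ℝ, 0 ≤ t ∧ h z = h 0 + t • v := by
  by_contra! hcon
  have hK : IsCompact (h '' Metric.closedBall 0 1) := (isCompact_closedBall 0 1).image hc
  set γ : ℝ → F := fun t => h 0 + t • v with hγ
  have hγc : Continuous γ := by fun_prop
  set C : Set ℝ := γ ⁻¹' (h '' Metric.closedBall 0 1) ∩ Set.Ici 0 with hC
  have hCc : IsClosed C := (hK.isClosed.preimage hγc).inter isClosed_Ici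
  have h0 : (0 : ℝ) ∈ C := ⟨⟨0, by simp, by simp [hγ]⟩, by simp⟩
  have hb : BddAbove C := by
    obtain ⟨r, hr⟩ := hK.isBounded.exists_norm_le
    refine ⟨(r + ‖h 0‖) / ‖v‖, fun t ht => ?_⟩
    have h1 := hr _ ht.1
    have h2 : ‖t • v‖ ≤ ‖γ t‖ + ‖h 0‖ := by
      have : t • v = γ t - h 0 := by simp [hγ]
      rw [this]; exact norm_sub_le _ _
    rw [norm_smul, Real.norm_of_nonneg ht.2] at h2
    rw [le_div_iff₀ (norm_pos_iff.2 hv)]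
    linarith
  -- At the last parameter in `C` the preimage `z` is off the sphere, hence in the open ball, whose
  -- image is open; so `C` extends further, a contradiction.
  obtain ⟨⟨z, hz, hzT⟩, hT⟩ := hCc.csSup_mem ⟨0, h0⟩ hb
  have hz1 : z ∈ Metric.ball (0 : E) 1 := by
    rw [mem_closedBall_zero_iff] at hz
    exact mem_ball_zero_iff.2 (lt_of_le_of_ne hz fun e => hcon z e _ hT hzT)
  have hA : IsOpen (γ ⁻¹' (h '' Metric.ball 0 1)) := (ho _ Metric.isOpen_ball).preimage hγc
  obtain ⟨r, hr, hrA⟩ := Metric.isOpen_iff.1 hA (sSup C) ⟨z, hz1, hzT⟩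
  have hm : sSup C + r / 2 ∈ C := by
    refine ⟨Set.image_mono Metric.ball_subset_closedBall (hrA ?_), ?_⟩
    · rw [Metric.mem_ball, Real.dist_eq, add_sub_cancel_left, abs_of_pos (by positivity)]
      linarith
    · have : 0 ≤ sSup C := hT
      exact Set.mem_Ici.2 (by positivity)
  linarith [le_csSup hb hm]

/-- The open map `h` stands for the layers already passed; quantifying over it lets the induction on
the remaining layers absorb each injective one. -/
theorem exists_norm_eq_one_net_le {σ : Set (ℝ → ℝ)}
    (hσ : ∀ s ∈ σ, StrictMono s ∧ Continuous s) {m n : ℕ} (hm : 0 < m) (j : Fin n) :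
    ∀ (ds : List ℕ), (∀ d ∈ ds, d ≤ m) → ∀ Φ ∈ Nets σ m ds n,
      ∀ h : (Fin m → ℝ) → (Fin m → ℝ), Continuous h → IsOpenMap h →
        ∃ z : Fin m → ℝ, ‖z‖ = 1 ∧ Φ (h z) j ≤ Φ (h 0) j := by
  intro ds
  induction ds with
  | nil =>
    rintro - Φ ⟨W, b, rfl⟩ h hc ho
    have : ∃ v : Fin m → ℝ, v ≠ 0 ∧ W.mulVec v j ≤ 0 := by
      have h1 : (1 : Fin m → ℝ) ≠ 0 := fun e => one_ne_zero (congrFun e ⟨0, hm⟩)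
      rcases le_total (W.mulVec 1 j) 0 with hle | hle
      · exact ⟨1, h1, hle⟩
      · exact ⟨-1, neg_ne_zero.2 h1, by simpa [Matrix.mulVec_neg] using hle⟩
    obtain ⟨v, hv, hvj⟩ := this
    obtain ⟨z, hz, t, ht, hzt⟩ := exists_mem_ray_of_isOpenMap hc ho hv
    refine ⟨z, hz, ?_⟩
    simp only [affineMap, hzt, Matrix.mulVec_add, Matrix.mulVec_smul, Pi.add_apply, Pi.smul_apply,
      smul_eq_mul]
    have := mul_nonpos_of_nonneg_of_nonpos ht hvj
    linarith
  | cons d ds ih =>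
    rintro hds Φ ⟨W, b, s, hs, Ψ, hΨ, rfl⟩ h hc ho
    by_cases hW : Function.Injective W.mulVecLin
    · have hmd : m ≤ d := by simpa using LinearMap.finrank_le_finrank_of_injective hW
      obtain rfl : d = m := le_antisymm (hds d (by simp)) hmd
      obtain ⟨hs1, hs2⟩ := hσ s hs
      have hWo : IsOpenMap W.mulVecLin :=
        W.mulVecLin.isOpenMap_of_finiteDimensional (LinearMap.injective_iff_surjective.1 hW)
      refine ih (fun d hd => hds d (by simp [hd])) Ψ hΨ
        (componentwise s ∘ affineMap W b ∘ h) ?_ ?_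
      · refine Continuous.comp ?_ (Continuous.comp ?_ hc)
        · unfold componentwise; fun_prop
        · unfold affineMap; fun_prop
      · refine IsOpenMap.comp ?_ (IsOpenMap.comp ?_ ho)
        · exact IsOpenMap.piMap (fun _ => isOpenMap_of_strictMono_of_continuous hs1 hs2) (by simp)
        · exact (isOpenMap_add_right b).comp hWo
    · obtain ⟨v, hv0, hv⟩ : ∃ v, W.mulVecLin v = 0 ∧ v ≠ 0 := by
        rw [injective_iff_map_eq_zero] at hW
        push Not at hW
        exact hW
      obtain ⟨z, hz, t, ht, hzt⟩ := exists_mem_ray_of_isOpenMap hc ho hv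
      refine ⟨z, hz, le_of_eq ?_⟩
      have : W.mulVec v = 0 := hv0
      simp [affineMap, hzt, Matrix.mulVec_add, Matrix.mulVec_smul, this]

theorem lt_of_mem_sufficientWidths {σ : Set (ℝ → ℝ)}
    (hσ : ∀ s ∈ σ, StrictMono s ∧ Continuous s) {m n l : ℕ} (hm : 0 < m) (hn : 0 < n)
    (hl : l ∈ sufficientWidths m n σ) : m < l := by
  by_contra! hlm
  -- The norm is `1` on the sphere and `0` at the centre, so error `1 / 3` forces values above `2 /
  -- 3` and below `1 / 3`.
  obtain ⟨g, ⟨ds, -, hds, hg⟩, hgf⟩ := hl (fun x _ => ‖x‖)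
    (show Continuous fun (x : Fin m → ℝ) (_ : Fin n) => ‖x‖ by fun_prop)
    (Metric.closedBall 0 1) (isCompact_closedBall 0 1) (1 / 3) (by norm_num)
  obtain ⟨z, hz, hle⟩ := exists_norm_eq_one_net_le hσ hm ⟨0, hn⟩ ds
    (fun d hd => (hds d hd).2.trans hlm) g hg id continuous_id IsOpenMap.id
  have h1 := (norm_le_pi_norm _ (⟨0, hn⟩ : Fin n)).trans_lt (hgf z (by simp [hz]))
  have h2 := (norm_le_pi_norm _ (⟨0, hn⟩ : Fin n)).trans_lt (hgf 0 (by simp))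
  simp only [Pi.sub_apply, hz, norm_zero, Real.norm_eq_abs, abs_lt, id] at h1 h2 hle
  linarith [h1.2, h2.1]

/-! ### Closure properties of networks -/

theorem nets_comp_affineMap {σ : Set (ℝ → ℝ)} {a b n : ℕ} (ds : List ℕ)
    (W : Matrix (Fin b) (Fin a) ℝ) (c : Fin b → ℝ) {Ψ : (Fin b → ℝ) → (Fin n → ℝ)}
    (hΨ : Ψ ∈ Nets σ b ds n) : Ψ ∘ affineMap W c ∈ Nets σ a ds n := by
  have key : ∀ {e : ℕ} (V : Matrix (Fin e) (Fin b) ℝ) (v : Fin e → ℝ),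
      affineMap V v ∘ affineMap W c = affineMap (V * W) (V.mulVec c + v) := by
    intro e V v
    funext x
    simp [affineMap, Matrix.mulVec_add, Matrix.mulVec_mulVec, add_assoc]
  cases ds with
  | nil =>
    obtain ⟨V, v, rfl⟩ := hΨ
    exact ⟨_, _, key V v⟩
  | cons d ds =>
    obtain ⟨V, v, s, hs, Θ, hΘ, rfl⟩ := hΨ
    exact ⟨_, _, s, hs, Θ, hΘ, by rw [← key]; rfl⟩

theorem nets_comp {σ : Set (ℝ → ℝ)} {b n : ℕ} (es : List ℕ) {Ψ : (Fin b → ℝ) → (Fin n → ℝ)}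
    (hΨ : Ψ ∈ Nets σ b es n) (ds : List ℕ) :
    ∀ {a : ℕ} {Φ : (Fin a → ℝ) → (Fin b → ℝ)}, Φ ∈ Nets σ a ds b →
      Ψ ∘ Φ ∈ Nets σ a (ds ++ es) n := by
  induction ds with
  | nil =>
    rintro a Φ ⟨W, c, rfl⟩
    exact nets_comp_affineMap es W c hΨ
  | cons d ds ih =>
    rintro a Φ ⟨W, c, s, hs, Θ, hΘ, rfl⟩
    exact ⟨W, c, s, hs, Ψ ∘ Θ, ih hΘ, rfl⟩

theorem netsOfWidth_comp {σ : Set (ℝ → ℝ)} {a b n k : ℕ} {Φ : (Fin a → ℝ) → (Fin b → ℝ)}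
    {Ψ : (Fin b → ℝ) → (Fin n → ℝ)} (hΦ : Φ ∈ NetsOfWidth σ a b k)
    (hΨ : Ψ ∈ NetsOfWidth σ b n k) : Ψ ∘ Φ ∈ NetsOfWidth σ a n k := by
  obtain ⟨ds, h1, h2, h3⟩ := hΦ
  obtain ⟨es, -, h5, h6⟩ := hΨ
  exact ⟨ds ++ es, by simp [h1], fun d hd => (List.mem_append.1 hd).elim (h2 d) (h5 d),
    nets_comp es h6 ds h3⟩

theorem affineMap_comp_netsOfWidth {σ : Set (ℝ → ℝ)} {a b n k : ℕ}
    {Φ : (Fin a → ℝ) → (Fin b → ℝ)} (hΦ : Φ ∈ NetsOfWidth σ a b k)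
    (W : Matrix (Fin n) (Fin b) ℝ) (c : Fin n → ℝ) :
    affineMap W c ∘ Φ ∈ NetsOfWidth σ a n k := by
  obtain ⟨ds, h1, h2, h3⟩ := hΦ
  exact ⟨ds, h1, h2, by simpa using nets_comp [] ⟨W, c, rfl⟩ ds h3⟩

/-! ### Compositions of approximable maps -/

theorem CompactlyApproximates.comp {a b n : ℕ} {𝓐 : Set ((Fin a → ℝ) → (Fin b → ℝ))}
    {𝓑 : Set ((Fin b → ℝ) → (Fin n → ℝ))} {𝓒 : Set ((Fin a → ℝ) → (Fin n → ℝ))}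
    {F : (Fin a → ℝ) → (Fin b → ℝ)} {G : (Fin b → ℝ) → (Fin n → ℝ)}
    (hF : CompactlyApproximates 𝓐 {F}) (hG : CompactlyApproximates 𝓑 {G}) (hFc : Continuous F)
    (hGc : Continuous G) (h : ∀ φ ∈ 𝓐, ∀ ψ ∈ 𝓑, ψ ∘ φ ∈ 𝓒) :
    CompactlyApproximates 𝓒 {G ∘ F} := by
  rintro _ rfl K hK ε hε
  -- The outer approximant is evaluated at `φ x`, which is only near `F '' K`.
  have hK' : IsCompact (Metric.cthickening 1 (F '' K)) := (hK.image hFc).cthickening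
  obtain ⟨δ, hδ, hδG⟩ := Metric.uniformContinuousOn_iff.1
    (hK'.uniformContinuousOn_of_continuous hGc.continuousOn) (ε / 2) (by positivity)
  obtain ⟨ψ, hψ, hψG⟩ := hG G rfl _ hK' (ε / 2) (by positivity)
  obtain ⟨φ, hφ, hφF⟩ := hF F rfl K hK (min δ 1) (by positivity)
  refine ⟨ψ ∘ φ, h φ hφ ψ hψ, fun x hx => ?_⟩
  have h1 := hφF x hx
  rw [← dist_eq_norm] at h1
  have hFx : F x ∈ Metric.cthickening 1 (F '' K) :=
    Metric.self_subset_cthickening _ (Set.mem_image_of_mem F hx)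
  have hφx : φ x ∈ Metric.cthickening 1 (F '' K) :=
    Metric.mem_cthickening_of_dist_le _ (F x) _ _ (Set.mem_image_of_mem F hx)
      (by rw [dist_comm]; exact (h1.trans_le (min_le_right _ _)).le)
  have h2 := hδG _ hFx _ hφx (h1.trans_le (min_le_left _ _))
  have h3 := hψG _ hφx
  rw [dist_eq_norm] at h2
  calc ‖(G ∘ F) x - (ψ ∘ φ) x‖ ≤ ‖G (F x) - G (φ x)‖ + ‖G (φ x) - ψ (φ x)‖ :=
        norm_sub_le_norm_sub_add_norm_sub _ _ _
    _ < ε := by linarith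

theorem continuous_affineMap {d e : ℕ} (W : Matrix (Fin e) (Fin d) ℝ) (b : Fin e → ℝ) :
    Continuous (affineMap W b) := by
  unfold affineMap; fun_prop

/-- A map that on every compact set is computed by a ReLU network with one hidden layer of width
`d` is approximable by `σ`-networks of that width. -/
theorem ApproximatesReLU.one_layer {σ : Set (ℝ → ℝ)} (hσ : ApproximatesReLU σ) {a b d : ℕ}
    (hd : 1 ≤ d) {F : (Fin a → ℝ) → (Fin b → ℝ)}
    (hF : ∀ K : Set (Fin a → ℝ), IsCompact K →
      ∃ (W : Matrix (Fin d) (Fin a) ℝ) (c : Fin d → ℝ) (W' : Matrix (Fin b) (Fin d) ℝ)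
        (c' : Fin b → ℝ), ∀ x ∈ K,
          F x = affineMap W' c' (componentwise (fun t => max t 0) (affineMap W c x))) :
    CompactlyApproximates (NetsOfWidth σ a b d) {F} := by
  rintro _ rfl K hK ε hε
  obtain ⟨W, c, W', c', hx⟩ := hF K hK
  have hr : CompactlyApproximates (Nets σ a [d] d)
      {componentwise (fun t => max t 0) ∘ affineMap W c} := by
    rintro _ rfl K hK ε hε
    obtain ⟨R, hR⟩ := (hK.image (continuous_affineMap W c)).isBounded.exists_norm_le
    obtain ⟨s, hs, hsR⟩ := hσ R ε hε
    refine ⟨_, ⟨W, c, s, hs, id, ⟨1, 0, by funext x; simp [affineMap]⟩, rfl⟩, fun x hx => ?_⟩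
    rw [pi_norm_lt_iff hε]
    intro i
    rw [Pi.sub_apply, norm_sub_rev]
    exact hsR _ ((norm_le_pi_norm (affineMap W c x) i).trans (hR _ (Set.mem_image_of_mem _ hx)))
  have hW' : CompactlyApproximates (Nets σ d [] b) {affineMap W' c'} := by
    rintro _ rfl K - ε hε
    exact ⟨_, ⟨W', c', rfl⟩, fun x _ => by simpa using hε⟩
  have hcont : Continuous (componentwise (fun t : ℝ => max t 0) ∘ affineMap W c) := by
    refine Continuous.comp ?_ (continuous_affineMap W c)
    unfold componentwise; fun_prop
  obtain ⟨g, hg, hgK⟩ := hr.comp hW' hcont (continuous_affineMap W' c')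
    (fun φ hφ ψ hψ => nets_comp [] hψ [d] hφ) _ rfl K hK ε hε
  exact ⟨g, ⟨[d], by simp, by simpa using hd, hg⟩, fun x hxK => by
    rw [hx x hxK]; exact hgK x hxK⟩

/-! ### Affine functions -/

/-- `f` is an affine function on `ℝᵈ`. -/
def IsAffine {d : ℕ} (f : (Fin d → ℝ) → ℝ) : Prop :=
  ∃ (L : (Fin d → ℝ) →ₗ[ℝ] ℝ) (c : ℝ), ∀ x, f x = L x + c

namespace IsAffine

variable {d : ℕ} {f g : (Fin d → ℝ) → ℝ}

theorem const (c : ℝ) : IsAffine fun _ : Fin d → ℝ => c := ⟨0, c, by simp⟩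

theorem coord (i : Fin d) : IsAffine fun x => x i := ⟨LinearMap.proj i, 0, by simp⟩

theorem add (hf : IsAffine f) (hg : IsAffine g) : IsAffine fun x => f x + g x := by
  obtain ⟨L, c, h⟩ := hf
  obtain ⟨L', c', h'⟩ := hg
  exact ⟨L + L', c + c', fun x => by dsimp only; rw [h, h', LinearMap.add_apply]; ring⟩

theorem const_mul (hf : IsAffine f) (k : ℝ) : IsAffine fun x => k * f x := by
  obtain ⟨L, c, h⟩ := hf
  exact ⟨k • L, k * c, fun x => by dsimp only; rw [h, LinearMap.smul_apply, smul_eq_mul]; ring⟩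

theorem sub (hf : IsAffine f) (hg : IsAffine g) : IsAffine fun x => f x - g x := by
  simpa [sub_eq_add_neg] using hf.add (hg.const_mul (-1))

theorem comp_right {e : ℕ} (hf : IsAffine f) {T : (Fin e → ℝ) → (Fin d → ℝ)}
    (hT : ∀ i, IsAffine fun x => T x i) : IsAffine fun x => f (T x) := by
  obtain ⟨L, c, h⟩ := hf
  choose M k hM using hT
  have : ∀ x, T x = LinearMap.pi M x + k := fun x => funext fun i => hM i x
  exact ⟨L ∘ₗ LinearMap.pi M, L k + c, fun x => by
    dsimp only
    rw [h, this, map_add, LinearMap.comp_apply]; ring⟩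

theorem continuous (hf : IsAffine f) : Continuous f := by
  obtain ⟨L, c, h⟩ := hf
  rw [funext h]
  exact L.continuous_of_finiteDimensional.add continuous_const

theorem exists_affineMap {e : ℕ} {T : (Fin d → ℝ) → (Fin e → ℝ)}
    (hT : ∀ i, IsAffine fun x => T x i) :
    ∃ (W : Matrix (Fin e) (Fin d) ℝ) (b : Fin e → ℝ), T = affineMap W b := by
  choose M k hM using hT
  refine ⟨LinearMap.toMatrix' (LinearMap.pi M), k, ?_⟩
  funext x i
  simp [affineMap, LinearMap.toMatrix'_mulVec, hM]

theorem append {e e' : ℕ} {S : (Fin d → ℝ) → (Fin e → ℝ)} {T : (Fin d → ℝ) → (Fin e' → ℝ)}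
    (hS : ∀ i, IsAffine fun x => S x i) (hT : ∀ i, IsAffine fun x => T x i) (i : Fin (e + e')) :
    IsAffine fun x => Fin.append (S x) (T x) i := by
  refine Fin.addCases (fun i => ?_) (fun i => ?_) i
  · simpa using hS i
  · simpa using hT i

end IsAffine

theorem componentwise_append {d e : ℕ} (s : ℝ → ℝ) (x : Fin d → ℝ) (y : Fin e → ℝ) :
    componentwise s (Fin.append x y) = Fin.append (componentwise s x) (componentwise s y) := by
  funext i
  refine Fin.addCases (fun i => ?_) (fun i => ?_) i <;> simp [componentwise]

/-! ### Updating registers -/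

/-- `g` is continuous and `x ↦ (x, g x)` is approximable by networks of width `m + n`. -/
def IsRegister (σ : Set (ℝ → ℝ)) {m n : ℕ} (g : (Fin m → ℝ) → (Fin n → ℝ)) : Prop :=
  Continuous g ∧
    CompactlyApproximates (NetsOfWidth σ m (m + n) (m + n)) {fun x => Fin.append x (g x)}

theorem continuous_append {X : Type*} [TopologicalSpace X] {m n : ℕ} {f : X → Fin m → ℝ}
    {g : X → Fin n → ℝ} (hf : Continuous f) (hg : Continuous g) :
    Continuous fun x => Fin.append (f x) (g x) :=
  (Fin.appendHomeomorph (X := ℝ) m n).continuous.comp (hf.prodMk hg)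

/-- Shifting by `B` makes ReLU act as the identity on the carried coordinates. -/
theorem exists_forall_coord_le {d : ℕ} {K : Set (Fin d → ℝ)} (hK : IsCompact K) :
    ∃ B : ℝ, ∀ x ∈ K, ∀ i, 0 ≤ x i + B := by
  obtain ⟨B, hB⟩ := hK.isBounded.exists_norm_le
  refine ⟨B, fun x hx i => ?_⟩
  have h1 := (norm_le_pi_norm x i).trans (hB x hx)
  rw [Real.norm_eq_abs] at h1
  linarith [neg_abs_le (x i)]

theorem isRegister_zero {σ : Set (ℝ → ℝ)} (hσ : ApproximatesReLU σ) {m n : ℕ} (hm : 0 < m) :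
    IsRegister σ (fun (_ : Fin m → ℝ) (_ : Fin n) => (0 : ℝ)) := by
  refine ⟨by fun_prop, hσ.one_layer (d := m + n) (by omega) fun K hK => ?_⟩
  obtain ⟨B, hB⟩ := exists_forall_coord_le hK
  obtain ⟨W, c, hW⟩ := IsAffine.exists_affineMap (IsAffine.append (e' := n)
    (S := fun x : Fin m → ℝ => fun i => x i + B) (T := fun _ _ => 0)
    (fun i => (IsAffine.coord i).add (.const B)) (fun _ => .const 0))
  obtain ⟨W', c', hW'⟩ := IsAffine.exists_affineMap (IsAffine.append (d := m + n)
    (S := fun z (i : Fin m) => z (Fin.castAdd n i) - B) (T := fun z i => z (Fin.natAdd m i))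
    (fun i => (IsAffine.coord _).sub (.const B)) (fun _ => .coord _))
  refine ⟨W, c, W', c', fun x hx => ?_⟩
  rw [← hW, ← hW']
  dsimp only
  rw [componentwise_append]
  simp only [Fin.append_left, Fin.append_right, componentwise]
  congr 1
  · funext i
    rw [max_eq_left (hB x hx i)]; ring
  · simp

/-- `V` is subtracted before the activation and can be added back after it, because the input
survives in the other coordinates. The values `κ = 1` and `κ = -1` give maximum and minimum. -/
theorem approximates_register_update {σ : Set (ℝ → ℝ)} (hσ : ApproximatesReLU σ) {m n : ℕ}
    (hm : 0 < m) {V : (Fin m → ℝ) → (Fin n → ℝ)} (hV : ∀ j, IsAffine fun x => V x j) (κ : ℝ) :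
    CompactlyApproximates (NetsOfWidth σ (m + n) (m + n) (m + n))
      {fun z => Fin.append (fun i => z (Fin.castAdd n i)) fun j =>
        V (fun i => z (Fin.castAdd n i)) j +
          κ * max (κ * (z (Fin.natAdd m j) - V (fun i => z (Fin.castAdd n i)) j)) 0} := by
  refine hσ.one_layer (by omega) fun K hK => ?_
  obtain ⟨B, hB⟩ := exists_forall_coord_le hK
  obtain ⟨W, c, hW⟩ := IsAffine.exists_affineMap (IsAffine.append (d := m + n)
    (S := fun z (i : Fin m) => z (Fin.castAdd n i) + B)
    (T := fun z j => κ * (z (Fin.natAdd m j) - V (fun i => z (Fin.castAdd n i)) j))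
    (fun i => (IsAffine.coord _).add (.const B))
    (fun j => ((IsAffine.coord _).sub ((hV j).comp_right fun i => .coord _)).const_mul κ))
  obtain ⟨W', c', hW'⟩ := IsAffine.exists_affineMap (IsAffine.append (d := m + n)
    (S := fun z (i : Fin m) => z (Fin.castAdd n i) - B)
    (T := fun z j => V (fun i => z (Fin.castAdd n i) - B) j + κ * z (Fin.natAdd m j))
    (fun i => (IsAffine.coord _).sub (.const B))
    (fun j => ((hV j).comp_right fun i => (IsAffine.coord _).sub (.const B)).add
      ((IsAffine.coord _).const_mul κ)))
  refine ⟨W, c, W', c', fun z hz => ?_⟩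
  rw [← hW, ← hW']
  dsimp only
  rw [componentwise_append]
  have hz' : ∀ i : Fin m, max (z (Fin.castAdd n i) + B) 0 - B = z (Fin.castAdd n i) := fun i => by
    rw [max_eq_left (hB z hz _)]; ring
  simp only [Fin.append_left, Fin.append_right, componentwise, hz']

theorem IsRegister.update {σ : Set (ℝ → ℝ)} (hσ : ApproximatesReLU σ) {m n : ℕ} (hm : 0 < m)
    {g V : (Fin m → ℝ) → (Fin n → ℝ)} (hg : IsRegister σ g)
    (hV : ∀ j, IsAffine fun x => V x j) (κ : ℝ) :
    IsRegister σ fun x j => V x j + κ * max (κ * (g x j - V x j)) 0 := by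
  have hVc : Continuous V := continuous_pi fun j => (hV j).continuous
  have hgc := hg.1
  refine ⟨by fun_prop, ?_⟩
  have := hg.2.comp (approximates_register_update hσ hm hV κ) (continuous_append continuous_id hgc)
    (continuous_append (by fun_prop) (by fun_prop)) fun φ hφ ψ hψ => netsOfWidth_comp hφ hψ
  simpa [Function.comp_def] using this

theorem IsRegister.sup {σ : Set (ℝ → ℝ)} (hσ : ApproximatesReLU σ) {m n : ℕ} (hm : 0 < m)
    {g V : (Fin m → ℝ) → (Fin n → ℝ)} (hg : IsRegister σ g)
    (hV : ∀ j, IsAffine fun x => V x j) : IsRegister σ fun x j => max (g x j) (V x j) := by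
  convert hg.update hσ hm hV 1 using 3 with x j
  rw [one_mul, one_mul, ← max_add_add_left]
  simp

theorem IsRegister.inf {σ : Set (ℝ → ℝ)} (hσ : ApproximatesReLU σ) {m n : ℕ} (hm : 0 < m)
    {g V : (Fin m → ℝ) → (Fin n → ℝ)} (hg : IsRegister σ g)
    (hV : ∀ j, IsAffine fun x => V x j) : IsRegister σ fun x j => min (g x j) (V x j) := by
  convert hg.update hσ hm hV (-1) using 3 with x j
  rcases le_total (g x j) (V x j) with h | h
  · rw [min_eq_left h, max_eq_left (by linarith)]; ring
  · rw [min_eq_right h, max_eq_right (by linarith)]; ring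

theorem IsRegister.compactlyApproximates {σ : Set (ℝ → ℝ)} {m n : ℕ}
    {g : (Fin m → ℝ) → (Fin n → ℝ)} (hg : IsRegister σ g) :
    CompactlyApproximates (NetsOfWidth σ m n (m + n)) {g} := by
  obtain ⟨W, c, hW⟩ := IsAffine.exists_affineMap (d := m + n)
    (T := fun z (j : Fin n) => z (Fin.natAdd m j)) fun j => .coord _
  have hW' : CompactlyApproximates {affineMap W c} {affineMap W c} := by
    rintro _ rfl K - ε hε
    exact ⟨_, rfl, fun x _ => by simpa using hε⟩
  have := hg.2.comp (𝓒 := NetsOfWidth σ m n (m + n)) hW'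
    (continuous_append continuous_id hg.1) (continuous_affineMap W c) (by
      rintro φ hφ _ rfl
      exact affineMap_comp_netsOfWidth hφ W c)
  rw [← hW] at this
  simpa [Function.comp_def] using this

/-! ### Approximation by iterated clamping -/

theorem dotProduct_sub_identity {m : ℕ} (p x : Fin m → ℝ) :
    2 * (p ⬝ᵥ (x - p)) = x ⬝ᵥ x - p ⬝ᵥ p - (x - p) ⬝ᵥ (x - p) := by
  simp only [dotProduct_sub, sub_dotProduct, dotProduct_comm x p]
  ring

theorem norm_sq_le_dotProduct_self {m : ℕ} (x : Fin m → ℝ) : ‖x‖ ^ 2 ≤ x ⬝ᵥ x := by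
  have h0 : 0 ≤ x ⬝ᵥ x := Finset.sum_nonneg fun i _ => mul_self_nonneg (x i)
  have : ‖x‖ ≤ √(x ⬝ᵥ x) := by
    rw [pi_norm_le_iff_of_nonneg (Real.sqrt_nonneg _)]
    intro i
    rw [Real.norm_eq_abs]
    refine Real.abs_le_sqrt ?_
    rw [sq]
    exact Finset.single_le_sum (f := fun i => x i * x i) (fun i _ => mul_self_nonneg (x i))
      (Finset.mem_univ i)
  calc ‖x‖ ^ 2 ≤ √(x ⬝ᵥ x) ^ 2 := by gcongr
    _ = x ⬝ᵥ x := Real.sq_sqrt h0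

/-- A continuous function on a compact set admits parabolic supports of uniform opening. -/
theorem exists_forall_norm_sub_le_add_mul {m n : ℕ} {f : (Fin m → ℝ) → (Fin n → ℝ)}
    {S : Set (Fin m → ℝ)} (hS : IsCompact S) (hf : Continuous f) {τ : ℝ} (hτ : 0 < τ) :
    ∃ M : ℝ, 0 ≤ M ∧ ∀ x ∈ S, ∀ p ∈ S, ‖f x - f p‖ ≤ τ + M * ((x - p) ⬝ᵥ (x - p)) := by
  obtain ⟨δ, hδ, hδf⟩ := Metric.uniformContinuousOn_iff.1
    (hS.uniformContinuousOn_of_continuous hf.continuousOn) τ hτ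
  obtain ⟨A, hA⟩ := (hS.image hf).isBounded.exists_norm_le
  -- Points closer than `δ` are covered by `τ`; for the others the quadratic term alone exceeds the
  -- oscillation bound `2 * |A|`.
  refine ⟨2 * |A| / δ ^ 2, by positivity, fun x hx p hp => ?_⟩
  have hq := norm_sq_le_dotProduct_self (x - p)
  by_cases h : dist x p < δ
  · have h1 := hδf x hx p hp h
    rw [dist_eq_norm] at h1
    have : 0 ≤ 2 * |A| / δ ^ 2 * ((x - p) ⬝ᵥ (x - p)) :=
      mul_nonneg (by positivity) ((sq_nonneg _).trans hq)
    linarith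
  · rw [dist_eq_norm, not_lt] at h
    have h1 : δ ^ 2 ≤ (x - p) ⬝ᵥ (x - p) := (by gcongr : δ ^ 2 ≤ ‖x - p‖ ^ 2).trans hq
    have h2 : 2 * |A| ≤ 2 * |A| / δ ^ 2 * ((x - p) ⬝ᵥ (x - p)) := by
      rw [div_mul_eq_mul_div, le_div_iff₀ (by positivity)]
      gcongr
    have h3 := hA _ (Set.mem_image_of_mem f hx)
    have h4 := hA _ (Set.mem_image_of_mem f hp)
    linarith [norm_sub_le (f x) (f p), le_abs_self A]

theorem isAffine_dotProduct_sub {m : ℕ} (p : Fin m → ℝ) (a k : ℝ) :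
    IsAffine fun x => a + k * (p ⬝ᵥ (x - p)) :=
  ⟨k • dotProductBilin ℝ ℝ p, a - k * (p ⬝ᵥ p), fun x => by
    simp only [dotProduct_sub, LinearMap.smul_apply, dotProductBilin_apply_apply, smul_eq_mul]
    ring⟩

theorem abs_clamp_sub_le {y V U b ε : ℝ} (hV : V ≤ b) (hU : b ≤ U) (hy : |y - b| ≤ ε) :
    |min (max y V) U - b| ≤ ε := by
  have h := abs_le.1 hy
  refine abs_le.2 ⟨?_, ?_⟩
  · have := le_min ((by linarith [h.1] : b - ε ≤ y).trans (le_max_left y V))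
      (by linarith [h.1, h.2] : b - ε ≤ U)
    linarith
  · have : max y V ≤ b + ε := max_le (by linarith [h.2]) (by linarith [h.1, h.2])
    linarith [min_le_left (max y V) U]

/-- The guarantee concerns only those `x` with a nearby centre of at least the same norm. Adding a
centre of maximal norm either serves `x` itself or clamps to an interval containing `f x`. -/
theorem exists_register_of_finset {σ : Set (ℝ → ℝ)} (hσ : ApproximatesReLU σ) {m n : ℕ}
    (hm : 0 < m) {f : (Fin m → ℝ) → (Fin n → ℝ)} {S : Set (Fin m → ℝ)} {τ M : ℝ} (hτ : 0 < τ)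
    (hM : 0 ≤ M)
    (hf : ∀ x ∈ S, ∀ p ∈ S, ‖f x - f p‖ ≤ τ + M * ((x - p) ⬝ᵥ (x - p)))
    (P : Finset (Fin m → ℝ)) : (↑P ⊆ S) →
    ∃ g : (Fin m → ℝ) → (Fin n → ℝ), IsRegister σ g ∧
      ∀ x ∈ S, (∃ p ∈ P, x ⬝ᵥ x ≤ p ⬝ᵥ p ∧ |2 * M * (p ⬝ᵥ (x - p))| ≤ τ ∧ ‖f x - f p‖ ≤ τ) →
        ∀ j, |g x j - f x j| ≤ 3 * τ := by
  induction P using Finset.induction_on_max_value (f := fun p : Fin m → ℝ => p ⬝ᵥ p) with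
  | empty => exact fun _ => ⟨_, isRegister_zero hσ hm, by simp⟩
  | insert a P ha hmax ih =>
    intro hPS
    rw [Finset.coe_insert, Set.insert_subset_iff] at hPS
    obtain ⟨g, hg, hgf⟩ := ih hPS.2
    refine ⟨_, (hg.sup hσ hm fun j => isAffine_dotProduct_sub a (f a j - τ) (2 * M)).inf hσ hm
      fun j => isAffine_dotProduct_sub a (f a j + τ) (-(2 * M)), ?_⟩
    rintro x hx ⟨p, hp, hqp, hdp, hfp⟩ j
    -- If the new centre serves `x`, both clamp bounds are within `2 * τ` of `f p j`, whatever the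
    -- old register held.
    rcases Finset.mem_insert.1 hp with rfl | hp
    · have h1 := abs_le.1 hdp
      have h2 := abs_le.1 ((norm_le_pi_norm (f x - f p) j).trans hfp)
      rw [Pi.sub_apply] at h2
      set w := 2 * M * (p ⬝ᵥ (x - p)) with hw
      have hw' : -(2 * M) * (p ⬝ᵥ (x - p)) = -w := by rw [hw]; ring
      rw [hw', abs_le]
      have h3 := le_min ((by linarith [h1.1] : f p j - 2 * τ ≤ f p j - τ + w).trans
        (le_max_right (g x j) _)) (by linarith [h1.2] : f p j - 2 * τ ≤ f p j + τ + -w)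
      have h4 := min_le_right (max (g x j) (f p j - τ + w)) (f p j + τ + -w)
      constructor <;> linarith [h1.1, h1.2, h2.1, h2.2]
    · have hqa := hqp.trans (hmax p hp)
      have h1 := abs_le.1 ((norm_le_pi_norm (f x - f a) j).trans (hf x hx a hPS.1))
      rw [Pi.sub_apply] at h1
      -- The ordering by norm enters here: `x ⬝ᵥ x ≤ a ⬝ᵥ a` lets the affine bounds open at least as
      -- wide as the parabolas.
      have h2 : 2 * M * (a ⬝ᵥ (x - a)) ≤ -(M * ((x - a) ⬝ᵥ (x - a))) := by
        have := dotProduct_sub_identity a x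
        nlinarith
      exact abs_clamp_sub_le (by linarith [h1.1]) (by linarith [h1.2])
        (hgf x hx ⟨p, hp, hqp, hdp, hfp⟩ j)

theorem exists_dotProduct_self_lt {m : ℕ} (hm : 0 < m) (x : Fin m → ℝ)
    {U : Set (Fin m → ℝ)} (hU : U ∈ 𝓝 x) : ∃ p ∈ U, x ⬝ᵥ x < p ⬝ᵥ p := by
  have : NeZero m := ⟨hm.ne'⟩
  -- Moving along these signs increases every `|x i|`, including at `x = 0`, where scaling `x` would
  -- fail.
  set v : Fin m → ℝ := fun i => if 0 ≤ x i then 1 else -1 with hv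
  have hc : Continuous fun t : ℝ => x + t • v := by fun_prop
  have h1 : ∀ᶠ t : ℝ in 𝓝[>] 0, x + t • v ∈ U :=
    (hc.tendsto' 0 x (by simp)).mono_left nhdsWithin_le_nhds hU
  obtain ⟨t, htU, ht⟩ := (h1.and self_mem_nhdsWithin).exists
  have ht : 0 < t := ht
  refine ⟨_, htU, Finset.sum_lt_sum_of_nonempty Finset.univ_nonempty fun i _ => ?_⟩
  simp only [hv, Pi.add_apply, Pi.smul_apply, smul_eq_mul]
  split_ifs with h <;> nlinarith

theorem add_mem_sufficientWidths {σ : Set (ℝ → ℝ)} (hσ : ApproximatesReLU σ) {m n : ℕ}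
    (hm : 0 < m) : m + n ∈ sufficientWidths m n σ := by
  intro f hfc K hK ε hε
  have hfc : Continuous f := hfc
  -- The register costs `3 * τ` and its approximation by a network one more `τ`.
  obtain ⟨τ, hτ, hτε⟩ : ∃ τ : ℝ, 0 < τ ∧ 4 * τ < ε := ⟨ε / 5, by positivity, by linarith⟩
  -- Centres must have larger norm than the points they serve, so they may lie outside `K`.
  have hS : IsCompact (Metric.cthickening 1 K) := hK.cthickening
  obtain ⟨M, hM, hMf⟩ := exists_forall_norm_sub_le_add_mul hS hfc hτ
  set N : (Fin m → ℝ) → Set (Fin m → ℝ) := fun p =>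
    {x | x ⬝ᵥ x < p ⬝ᵥ p ∧ |2 * M * (p ⬝ᵥ (x - p))| < τ ∧ ‖f x - f p‖ < τ} with hN
  have hcq : Continuous fun x : Fin m → ℝ => x ⬝ᵥ x := by fun_prop
  have hNo : ∀ p, IsOpen (N p) := fun p => by
    have h1 : Continuous fun x => |2 * M * (p ⬝ᵥ (x - p))| := by fun_prop
    have h2 : Continuous fun x => ‖f x - f p‖ := by fun_prop
    exact (isOpen_lt hcq continuous_const).inter
      ((isOpen_lt h1 continuous_const).inter (isOpen_lt h2 continuous_const))
  have hcover : ∀ x ∈ K, ∃ p ∈ Metric.cthickening 1 K, x ∈ N p := by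
    intro x hx
    have h1 : Metric.ball x 1 ∈ 𝓝 x := Metric.ball_mem_nhds x one_pos
    have h2 : {p | |2 * M * (p ⬝ᵥ (x - p))| < τ} ∈ 𝓝 x :=
      (isOpen_lt (by fun_prop) continuous_const).mem_nhds (by simpa using hτ)
    have h3 : {p | ‖f x - f p‖ < τ} ∈ 𝓝 x :=
      (isOpen_lt (by fun_prop) continuous_const).mem_nhds (by simpa using hτ)
    obtain ⟨p, ⟨⟨hp1, hp2⟩, hp3⟩, hp⟩ :=
      exists_dotProduct_self_lt hm x (inter_mem (inter_mem h1 h2) h3)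
    exact ⟨p, Metric.mem_cthickening_of_dist_le p x 1 K hx (Metric.mem_ball.1 hp1).le,
      hp, hp2, hp3⟩
  obtain ⟨P, hPS, hP, hKP⟩ := hK.elim_finite_subcover_image (b := Metric.cthickening 1 K)
    (c := N) (fun p _ => hNo p) fun x hx => by simpa using hcover x hx
  obtain ⟨g, hg, hgf⟩ := exists_register_of_finset hσ hm hτ hM hMf hP.toFinset (by simpa using hPS)
  obtain ⟨h, hh, hhg⟩ := hg.compactlyApproximates g rfl K hK τ hτ
  refine ⟨h, hh, fun x hx => ?_⟩
  obtain ⟨p, hp, hxp⟩ := Set.mem_iUnion₂.1 (hKP hx)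
  have h1 : ‖f x - g x‖ ≤ 3 * τ := by
    rw [pi_norm_le_iff_of_nonneg (by positivity)]
    intro j
    rw [Pi.sub_apply, norm_sub_rev]
    exact hgf x (Metric.self_subset_cthickening K hx)
      ⟨p, by simpa using hp, hxp.1.le, hxp.2.1.le, hxp.2.2.le⟩ j
  linarith [hhg x hx, norm_sub_le_norm_sub_add_norm_sub (f x) (g x) (h x)]

end MinWidth

theorem mainTheorem3 (m n : ℕ) (hm : 0 < m) (hn : 0 < n) (σ : Set (ℝ → ℝ))
    (hσ : σ = MinWidth.LeakyReLU ∨ σ = MinWidth.ELU ∨ σ = MinWidth.SELU ∨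
      σ = MinWidth.Softplus ∨ σ = MinWidth.CELU) :
    (MinWidth.sufficientWidths m n σ).Nonempty ∧
      m + 1 ≤ MinWidth.minWidth m n σ ∧ MinWidth.minWidth m n σ ≤ m + n := by
  have hσ' : MinWidth.IsReLUVariant σ := hσ
  have hmem : m + n ∈ MinWidth.sufficientWidths m n σ :=
    MinWidth.add_mem_sufficientWidths hσ'.approximatesReLU hm
  exact ⟨⟨_, hmem⟩, MinWidth.lt_of_mem_sufficientWidths
    (fun _ hs => hσ'.strictMono_continuous hs) hm hn (Nat.sInf_mem ⟨_, hmem⟩), Nat.sInf_le hmem⟩
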